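/- Let $d\ge 1$ and $0<q\le p<\infty$. For $r>0$ let $\mathcal E(r)$ be the space of all (smooth) tempered distributions on $\mathbb R^d$ whose Fourier transforms are supported in $\{\xi:|\xi|\le r\}$, where $\widehat f(\xi)=\int f(x)e^{-i\langle x,\xi\rangle}\,dx$. For an integer $n\ge 0$, $k\in\mathbb Z$ and $f:\mathbb R^d\to\mathbb C$ put $$\mathcal M^n_k f(x)=\sup_{|h|\le 2^{n-k+1}}|f(x+h)|,$$ and for a sequence $\{g_k\}_{k\in\mathbb Z}$ put $\|\{g_k\}\|_{L^p(\ell^q)}=\big\|\big(\sum_k|g_k|^q\big)^{1/q}\big\|_{L^p(\mathbb R^d)}\in[0,\infty]$. Then there is a constant $C=C(p,q,d)<\infty$ such that for all integers $n\ge 0$ and all sequences $\{f_k\}_{k\in\mathbb Z}$ with $f_k\in\mathcal E(2^k)$ for every $k$, $$\big\|\{\mathcal M^n_k f_k\}\big\|_{L^p(\ell^q)}\le C\,2^{nd/q}\,\big\|\{f_k\}\big\|_{L^p(\ell^q)}.$$ -/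

import Mathlib

open MeasureTheory
open scoped ENNReal NNReal SchwartzMap FourierTransform ContDiff

noncomputable section

/-- The class `𝓔(r)` of smooth functions on `ℝ^d` which are tempered distributions with Fourier
transform supported in `{ξ : |ξ| ≤ r}`.  The Fourier transform is normalised as
`∫ f(x) e^{-i⟨x, ξ⟩} dx`; Mathlib's `𝓕` has the kernel `e^{-2πi⟨x, ξ⟩}`, so that the ball of radius
`r` becomes the ball of radius `r / (2π)`.  A tempered distribution is supported in a closed set if
it annihilates every test function whose support lies in the complement. -/
def ExpType (d : ℕ) (r : ℝ) : Set (EuclideanSpace ℝ (Fin d) → ℂ) :=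
  {f | ContDiff ℝ ∞ f ∧
    ∃ u : 𝓢'(EuclideanSpace ℝ (Fin d), ℂ),
      (∀ φ : 𝓢(EuclideanSpace ℝ (Fin d), ℂ),
        Integrable (fun x => φ x * f x) ∧ u φ = ∫ x, φ x * f x) ∧
      Distribution.IsVanishingOn (𝓕 u : 𝓢'(EuclideanSpace ℝ (Fin d), ℂ))
        (Metric.closedBall (0 : EuclideanSpace ℝ (Fin d)) (r / (2 * Real.pi)))ᶜ}

/-- The local maximal operator `𝓜ⁿ_k f(x) = sup_{|h| ≤ 2^{n-k+1}} |f(x+h)|`. -/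
def localMax {d : ℕ} (n : ℕ) (k : ℤ) (f : EuclideanSpace ℝ (Fin d) → ℂ)
    (x : EuclideanSpace ℝ (Fin d)) : ℝ≥0∞ :=
  ⨆ (h : EuclideanSpace ℝ (Fin d)) (_ : ‖h‖ ≤ (2 : ℝ) ^ ((n : ℤ) - k + 1)), ‖f (x + h)‖ₑ

/-- The `L^p(ℓ^q)` (quasi-)norm `‖(∑_k g_k^q)^{1/q}‖_p` of a sequence of nonnegative functions on
`ℝ^d`, for `0 < p, q < ∞`. -/
def mixedNorm {d : ℕ} (p q : ℝ) (g : ℤ → EuclideanSpace ℝ (Fin d) → ℝ≥0∞) : ℝ≥0∞ :=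
  (∫⁻ x, ((∑' k, g k x ^ q) ^ (1 / q)) ^ p) ^ (1 / p)

end

/-! Fix `k` and let `θ` be the Fourier transform of a bump function in the unit ball, so that `θ 0 ≠
0`. Multiplying `f_k` by a copy of `θ` at scale `2^(-k)` keeps it band-limited and makes it
integrable. Bernstein–Nikolskii then bounds `|f_k y|^q` by a mean of `|f_k|^q` at scale `2^(-k)`
with rapidly decaying tails (`ExpType.enorm_rpow_mul_le`). For `y` within `2^(n-k+1)` of `x`,
enlarging the balls to be centred at `x` costs a volume factor `2^(nd)`. This gives
`localMax_rpow_le`: a superposition, with weights `2^(-l)`, of averages of `|f_k|^q` over balls of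
radius `2^(n+l+2-k)`.

With `s = p/q ≥ 1` it remains to bound the `L^s` norm of `∑ A_k g_k`, where `A_k` averages over
radius `2^(m-k)`, uniformly in `m`. This is `lintegral_tsum_ballAvg_rpow_le`. Expand the power by
partial sums, move `A_k` to the other factor by self-adjointness, and use that averages at coarser
scales are almost constant at scale `k`. Hölder then bounds the quantity by a power of itself with
doubled radii, which is the same problem reindexed. The best constant therefore satisfies `c ≤ D
c^(1-1/s)`, so `c ≤ D^s`. -/

set_option linter.unusedSectionVars false

/-- Jensen's inequality for powers and a measure of arbitrary total mass. -/
lemma rpow_lintegral_le {α : Type*} [MeasurableSpace α] (ν : Measure α) {s : ℝ} (hs : 1 ≤ s)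
    {f : α → ℝ≥0∞} (hf : AEMeasurable f ν) :
    (∫⁻ a, f a ∂ν) ^ s ≤ ν Set.univ ^ (s - 1) * ∫⁻ a, f a ^ s ∂ν := by
  rcases hs.eq_or_lt with rfl | hs
  · simp
  have hc : s.HolderConjugate (s / (s - 1)) := .conjExponent hs
  have h := ENNReal.lintegral_mul_le_Lp_mul_Lq ν hc hf (aemeasurable_const (b := (1 : ℝ≥0∞)))
  simp only [Pi.mul_apply, mul_one, ENNReal.one_rpow, lintegral_const, one_mul] at h
  refine (ENNReal.rpow_le_rpow h hc.nonneg).trans (le_of_eq ?_)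
  have hs0 : s ≠ 0 := hc.ne_zero
  have hs1 : s - 1 ≠ 0 := by linarith
  rw [ENNReal.mul_rpow_of_nonneg _ _ hc.nonneg, ← ENNReal.rpow_mul, ← ENNReal.rpow_mul,
    one_div_mul_cancel hs0, ENNReal.rpow_one, mul_comm,
    show 1 / (s / (s - 1)) * s = s - 1 by field_simp]

/-! ### Averages over balls of a fixed radius. -/

section BallAverage

open Metric Set

variable {E : Type*} [NormedAddCommGroup E] [NormedSpace ℝ E] [FiniteDimensional ℝ E]
  [MeasurableSpace E] [BorelSpace E] (μ : Measure E) [μ.IsAddHaarMeasure]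

/-- The average of a nonnegative function over the closed ball of radius `R` around a point. -/
noncomputable def ballAvg (R : ℝ) (g : E → ℝ≥0∞) (x : E) : ℝ≥0∞ :=
  (μ (closedBall (0 : E) R))⁻¹ * ∫⁻ z in closedBall x R, g z ∂μ

lemma measurableSet_dist_le (R : ℝ) : MeasurableSet {a : E × E | dist a.1 a.2 ≤ R} :=
  (isClosed_le (by fun_prop) (by fun_prop)).measurableSet

lemma setLIntegral_closedBall_eq (R : ℝ) (g : E → ℝ≥0∞) (x : E) :
    ∫⁻ z in closedBall x R, g z ∂μ =
      ∫⁻ z, {a : E × E | dist a.1 a.2 ≤ R}.indicator (fun a => g a.1) (z, x) ∂μ := by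
  rw [← lintegral_indicator measurableSet_closedBall]
  rfl

lemma measurable_ballAvg (R : ℝ) {g : E → ℝ≥0∞} (hg : Measurable g) :
    Measurable (ballAvg μ R g) := by
  unfold ballAvg
  simp_rw [setLIntegral_closedBall_eq]
  exact (Measurable.lintegral_prod_left'
    ((hg.comp measurable_fst).indicator (measurableSet_dist_le R))).const_mul _

/-- The kernel `1_{dist z x ≤ R}` is symmetric, so Tonelli gives self-adjointness. -/
lemma lintegral_mul_ballAvg_comm (R : ℝ) {g w : E → ℝ≥0∞} (hg : Measurable g)
    (hw : Measurable w) :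
    ∫⁻ x, w x * ballAvg μ R g x ∂μ = ∫⁻ x, g x * ballAvg μ R w x ∂μ := by
  have hms := measurableSet_dist_le (E := E) R
  have key : ∀ {u v : E → ℝ≥0∞}, Measurable u → Measurable v →
      ∫⁻ x, v x * ballAvg μ R u x ∂μ = (μ (closedBall (0 : E) R))⁻¹ * ∫⁻ x, ∫⁻ z,
        {a : E × E | dist a.1 a.2 ≤ R}.indicator (fun a => u a.1 * v a.2) (z, x) ∂μ ∂μ := by
    intro u v hu hv
    have hm : Measurable fun a : E × E => u a.1 * v a.2 :=
      (hu.comp measurable_fst).mul (hv.comp measurable_snd)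
    rw [← lintegral_const_mul _ (Measurable.lintegral_prod_left' (hm.indicator hms))]
    refine lintegral_congr fun x => ?_
    have hu' : Measurable fun z =>
        {a : E × E | dist a.1 a.2 ≤ R}.indicator (fun a => u a.1) (z, x) :=
      ((hu.comp measurable_fst).indicator hms).comp measurable_prodMk_right
    rw [ballAvg, setLIntegral_closedBall_eq, mul_left_comm, ← lintegral_const_mul _ hu']
    congr 1
    refine lintegral_congr fun z => ?_
    simp only [indicator_apply]
    split_ifs
    · exact mul_comm _ _
    · simp
  rw [key hg hw, key hw hg, lintegral_lintegral_swap]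
  · congr 1
    refine lintegral_congr fun x => lintegral_congr fun z => ?_
    simp only [indicator_apply, mem_ofPred_eq, dist_comm z x, mul_comm]
  · exact (((hg.comp measurable_fst).mul (hw.comp measurable_snd)).indicator hms).comp
      measurable_swap |>.aemeasurable

lemma measure_closedBall_ne_zero {R : ℝ} (hR : 0 < R) (x : E) : μ (closedBall x R) ≠ 0 :=
  (measure_closedBall_pos μ x hR).ne'

lemma ballAvg_const {R : ℝ} (hR : 0 < R) (c : ℝ≥0∞) (x : E) :
    ballAvg μ R (fun _ => c) x = c := by
  have h0 := measure_closedBall_ne_zero μ hR (0 : E)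
  have h1 : μ (closedBall (0 : E) R) ≠ ⊤ := measure_closedBall_lt_top.ne
  have h2 : μ (closedBall x R) = μ (closedBall (0 : E) R) := by
    rw [Measure.addHaar_closedBall μ x hR.le, Measure.addHaar_closedBall μ 0 hR.le]
  rw [ballAvg, setLIntegral_const, h2, mul_left_comm, ENNReal.inv_mul_cancel h0 h1, mul_one]

lemma ballAvg_le_of_forall_le {R : ℝ} (hR : 0 < R) {g : E → ℝ≥0∞} {c : ℝ≥0∞} {x : E}
    (h : ∀ y, dist y x ≤ R → g y ≤ c) : ballAvg μ R g x ≤ c := by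
  conv_rhs => rw [← ballAvg_const μ hR c x]
  unfold ballAvg
  gcongr 1
  exact setLIntegral_mono' measurableSet_closedBall fun y hy => h y hy

lemma lintegral_ballAvg {R : ℝ} (hR : 0 < R) {g : E → ℝ≥0∞} (hg : Measurable g) :
    ∫⁻ x, ballAvg μ R g x ∂μ = ∫⁻ x, g x ∂μ := by
  have := lintegral_mul_ballAvg_comm μ R hg (measurable_const (a := (1 : ℝ≥0∞)))
  simpa [ballAvg_const μ hR] using this

/-- The integral over a ball is at most that over a larger ball, which is a multiple of the average. -/
lemma setLIntegral_closedBall_le_ballAvg {R ρ : ℝ} (hρ : 0 < ρ) (g : E → ℝ≥0∞) {x y : E}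
    (h : dist y x + R ≤ ρ) :
    ∫⁻ z in closedBall y R, g z ∂μ ≤ μ (closedBall (0 : E) ρ) * ballAvg μ ρ g x := by
  rw [ballAvg, ← mul_assoc, ENNReal.mul_inv_cancel (measure_closedBall_ne_zero μ hρ 0)
    measure_closedBall_lt_top.ne, one_mul]
  exact lintegral_mono_set (closedBall_subset_closedBall' (by linarith))

/-- The ball around `y` lies in the doubled ball around `x`; the constant is the ratio of volumes.
-/
lemma ballAvg_le_two_mul {R : ℝ} (hR : 0 < R) (g : E → ℝ≥0∞) {x y : E} (h : dist y x ≤ R) :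
    ballAvg μ R g y ≤ 2 ^ Module.finrank ℝ E * ballAvg μ (2 * R) g x := by
  calc ballAvg μ R g y
      ≤ (μ (closedBall (0 : E) R))⁻¹ * (μ (closedBall (0 : E) (2 * R)) *
          ballAvg μ (2 * R) g x) := by
        unfold ballAvg
        gcongr
        exact setLIntegral_closedBall_le_ballAvg μ (by linarith) g (by linarith)
    _ = _ := by
        rw [Measure.addHaar_closedBall_mul μ 0 zero_le_two hR.le, ENNReal.ofReal_pow zero_le_two,
          mul_assoc, mul_left_comm, ← mul_assoc (μ _)⁻¹, ENNReal.inv_mul_cancel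
          (measure_closedBall_ne_zero μ hR 0) measure_closedBall_lt_top.ne, one_mul]
        simp

lemma ballAvg_rpow_le {R : ℝ} (hR : 0 < R) {s : ℝ} (hs : 1 ≤ s) {g : E → ℝ≥0∞}
    (hg : Measurable g) (x : E) :
    ballAvg μ R g x ^ s ≤ ballAvg μ R (fun z => g z ^ s) x := by
  have h0 := measure_closedBall_ne_zero μ hR (0 : E)
  have h1 : μ (closedBall (0 : E) R) ≠ ⊤ := measure_closedBall_lt_top.ne
  have h2 : μ (closedBall x R) = μ (closedBall (0 : E) R) := by
    rw [Measure.addHaar_closedBall μ x hR.le, Measure.addHaar_closedBall μ 0 hR.le]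
  have h := rpow_lintegral_le (μ.restrict (closedBall x R)) hs hg.aemeasurable
  rw [Measure.restrict_apply_univ, h2] at h
  unfold ballAvg
  rw [ENNReal.mul_rpow_of_nonneg _ _ (by linarith)]
  refine (mul_le_mul_right h _).trans (le_of_eq ?_)
  rw [← mul_assoc, ENNReal.inv_rpow, ← ENNReal.rpow_neg, ← ENNReal.rpow_add _ _ h0 h1,
    show -s + (s - 1) = -1 by ring, ENNReal.rpow_neg_one]

end BallAverage

/-! ### Power inequalities for sums, and self-improving constants. -/

/-- The convex function `x ^ s` lies above its tangent at `a + δ`; after scaling this is Bernoulli's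
inequality at `-δ / (a + δ)`. -/
lemma ENNReal.add_rpow_le_rpow_add_mul {s : ℝ} (hs : 1 ≤ s) (a δ : ℝ≥0∞) :
    (a + δ) ^ s ≤ a ^ s + ENNReal.ofReal s * ((a + δ) ^ (s - 1) * δ) := by
  have hs0 : 0 < s := by linarith
  rcases eq_or_ne a ⊤ with rfl | ha
  · simp [hs0]
  rcases eq_or_ne δ ⊤ with rfl | hδ
  · have h1 : (⊤ : ℝ≥0∞) ^ (s - 1) ≠ 0 := by
      rw [Ne, ENNReal.rpow_eq_zero_iff]
      simp; linarith
    simp [ENNReal.mul_top h1, ENNReal.mul_top, hs0]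
  lift a to ℝ≥0 using ha
  lift δ to ℝ≥0 using hδ
  rcases eq_or_ne δ 0 with rfl | hδ
  · simp
  have hpos : 0 < a + δ := by positivity
  rw [ENNReal.ofReal, ← ENNReal.coe_add, ← ENNReal.coe_rpow_of_nonneg _ hs0.le,
    ← ENNReal.coe_rpow_of_nonneg _ hs0.le, ← ENNReal.coe_rpow_of_nonneg _ (by linarith)]
  norm_cast
  rw [← NNReal.coe_le_coe]
  push_cast
  rw [Real.coe_toNNReal _ hs0.le]
  have hpos' : (0 : ℝ) < a + δ := by exact_mod_cast hpos
  have h := one_add_mul_self_le_rpow_one_add (s := -(δ / (a + δ) : ℝ)) (by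
    rw [neg_le_neg_iff, div_le_one hpos']; simp) hs
  have h2 : 1 + -(δ / (a + δ) : ℝ) = a / (a + δ) := by field_simp; ring
  rw [h2, Real.div_rpow a.coe_nonneg hpos'.le, le_div_iff₀ (by positivity)] at h
  have h3 : ((a : ℝ) + δ) ^ s = (a + δ) ^ (s - 1) * (a + δ) := by
    rw [← Real.rpow_add_one hpos'.ne']; simp
  have h4 : (1 + s * -(δ / (a + δ) : ℝ)) * (a + δ : ℝ) ^ s =
      (a + δ) ^ s - s * ((a + δ) ^ (s - 1) * δ) := by
    rw [h3]; field_simp; ring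
  linarith

/-- Discrete analogue of `(S ^ s)' = s S ^ (s - 1) S'`. -/
lemma ENNReal.rpow_sum_le_sum_partialSum_rpow_mul {s : ℝ} (hs : 1 ≤ s) (F : Finset ℤ)
    (a : ℤ → ℝ≥0∞) :
    (∑ k ∈ F, a k) ^ s ≤
      ENNReal.ofReal s * ∑ k ∈ F, (∑ j ∈ F with j ≤ k, a j) ^ (s - 1) * a k := by
  induction F using Finset.induction_on_max with
  | empty => simp; linarith
  | insert m F hm ih =>
    have hmF : m ∉ F := fun h => lt_irrefl _ (hm m h)
    have h1 : (insert m F).filter (· ≤ m) = insert m F := by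
      refine Finset.filter_true_of_mem fun j hj => ?_
      rcases Finset.mem_insert.1 hj with rfl | hj
      exacts [le_rfl, (hm j hj).le]
    have h2 : ∀ k ∈ F, (insert m F).filter (· ≤ k) = F.filter (· ≤ k) := fun k hk => by
      rw [Finset.filter_insert, if_neg (not_le.2 (hm k hk))]
    have h3 : ∑ k ∈ F, (∑ j ∈ insert m F with j ≤ k, a j) ^ (s - 1) * a k =
        ∑ k ∈ F, (∑ j ∈ F with j ≤ k, a j) ^ (s - 1) * a k :=
      Finset.sum_congr rfl fun k hk => by rw [h2 k hk]
    rw [Finset.sum_insert hmF, Finset.sum_insert hmF, h1, Finset.sum_insert hmF, mul_add, h3]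
    rw [add_comm (a m) (∑ k ∈ F, a k)]
    refine (ENNReal.add_rpow_le_rpow_add_mul hs _ _).trans ?_
    rw [add_comm]
    gcongr

/-- A finite constant `c` that can always be replaced by `D * c ^ t`, where `t < 1`, can be replaced
by the fixed point of this map. -/
lemma ENNReal.le_mul_of_self_improving {ι : Type*} {L R : ι → ℝ≥0∞} (hR : ∀ i, R i ≠ ⊤)
    {D : ℝ≥0∞} {t : ℝ} (ht1 : t < 1) {c₀ : ℝ≥0∞} (hc₀ : c₀ ≠ ⊤)
    (h₀ : ∀ i, L i ≤ c₀ * R i)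
    (h : ∀ c, c ≠ ⊤ → (∀ i, L i ≤ c * R i) → ∀ i, L i ≤ D * c ^ t * R i) (i : ι) :
    L i ≤ D ^ (1 / (1 - t)) * R i := by
  set S := {c : ℝ≥0∞ | ∀ i, L i ≤ c * R i} with hS
  have hc : sInf S ≠ ⊤ := ne_top_of_le_ne_top hc₀ (sInf_le h₀)
  -- The infimum is itself admissible, since each constraint with `R i ≠ 0` reads `L i / R i ≤ c`.
  have hmem : sInf S ∈ S := by
    intro i
    rcases eq_or_ne (R i) 0 with hR0 | hR0
    · simpa [hR0] using h₀ i
    · rw [← ENNReal.div_le_iff hR0 (hR i)]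
      exact le_sInf fun c hc => (ENNReal.div_le_iff hR0 (hR i)).2 (hc i)
  have hle : sInf S ≤ D * sInf S ^ t := sInf_le (h _ hc hmem)
  refine (hmem i).trans ?_
  gcongr
  rcases eq_or_ne (sInf S) 0 with h0 | h0
  · simp [h0]
  have h1 : sInf S ^ (1 - t) ≤ D := by
    rw [ENNReal.rpow_sub _ _ h0 hc, ENNReal.rpow_one]
    refine ENNReal.div_le_of_le_mul hle
  rw [one_div]
  exact (ENNReal.le_rpow_inv_iff (by linarith)).2 h1

/-! ### Vector-valued bound for averages at dyadic scales. -/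

section BallAverageSum

open Metric Set Finset

variable {E : Type*} [NormedAddCommGroup E] [NormedSpace ℝ E]
    [FiniteDimensional ℝ E] [MeasurableSpace E] [BorelSpace E] (μ : Measure E)
    [μ.IsAddHaarMeasure]

lemma lintegral_sum_ballAvg_rpow_le_of_double {s : ℝ} (hs : 1 < s) (F : Finset ℤ)
    {g : ℤ → E → ℝ≥0∞} (hg : ∀ k, Measurable (g k)) :
    ∫⁻ x, (∑ k ∈ F, ballAvg μ ((2 : ℝ) ^ (-k)) (g k) x) ^ s ∂μ ≤
      ENNReal.ofReal s * (2 ^ Module.finrank ℝ E) ^ (s - 1) *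
        ((∫⁻ x, (∑ k ∈ F, g k x) ^ s ∂μ) ^ (1 / s) *
        (∫⁻ x, (∑ k ∈ F, ballAvg μ (2 * (2 : ℝ) ^ (-k)) (g k) x) ^ s ∂μ) ^ (1 - 1 / s)) := by
  have hs1 : 0 < s - 1 := by linarith
  have hpow : ∀ k : ℤ, (0 : ℝ) < 2 ^ k := fun k => by positivity
  have hA : ∀ k, Measurable (ballAvg μ ((2 : ℝ) ^ (-k)) (g k)) := fun k =>
    measurable_ballAvg μ _ (hg k)
  have hA2 : Measurable fun x => ∑ k ∈ F, ballAvg μ (2 * (2 : ℝ) ^ (-k)) (g k) x :=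
    Finset.measurable_sum _ fun k _ => measurable_ballAvg μ _ (hg k)
  set T : E → ℝ≥0∞ := fun x => ∑ k ∈ F, ballAvg μ (2 * (2 : ℝ) ^ (-k)) (g k) x with hT
  have hP : ∀ k : ℤ, Measurable fun x =>
      (∑ j ∈ F with j ≤ k, ballAvg μ ((2 : ℝ) ^ (-j)) (g j) x) ^ (s - 1) := fun k =>
    (Finset.measurable_sum _ fun j _ => hA j).pow_const _
  have hPA : ∀ k : ℤ, Measurable fun x =>
      (∑ j ∈ F with j ≤ k, ballAvg μ ((2 : ℝ) ^ (-j)) (g j) x) ^ (s - 1) *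
        ballAvg μ ((2 : ℝ) ^ (-k)) (g k) x := fun k => (hP k).mul (hA k)
  have hgT : ∀ k : ℤ, Measurable fun x =>
      g k x * ((2 ^ Module.finrank ℝ E) ^ (s - 1) * T x ^ (s - 1)) := fun k =>
    (hg k).mul ((hA2.pow_const _).const_mul _)
  have hGT : Measurable fun x => (∑ k ∈ F, g k x) * T x ^ (s - 1) :=
    (Finset.measurable_sum _ fun k _ => hg k).mul (hA2.pow_const _)
  have hc : s.HolderConjugate (s / (s - 1)) := .conjExponent hs
  calc ∫⁻ x, (∑ k ∈ F, ballAvg μ ((2 : ℝ) ^ (-k)) (g k) x) ^ s ∂μ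
      ≤ ∫⁻ x, ENNReal.ofReal s * ∑ k ∈ F,
          (∑ j ∈ F with j ≤ k, ballAvg μ ((2 : ℝ) ^ (-j)) (g j) x) ^ (s - 1) *
            ballAvg μ ((2 : ℝ) ^ (-k)) (g k) x ∂μ :=
        lintegral_mono fun x => ENNReal.rpow_sum_le_sum_partialSum_rpow_mul hs.le F _
    _ = ENNReal.ofReal s * ∑ k ∈ F, ∫⁻ x, g k x * ballAvg μ ((2 : ℝ) ^ (-k)) (fun x =>
          (∑ j ∈ F with j ≤ k, ballAvg μ ((2 : ℝ) ^ (-j)) (g j) x) ^ (s - 1)) x ∂μ := by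
        rw [lintegral_const_mul _ (Finset.measurable_sum _ fun k _ => hPA k),
          lintegral_finsetSum _ fun k _ => hPA k]
        congr 1
        exact Finset.sum_congr rfl fun k _ => lintegral_mul_ballAvg_comm μ _ (hg k) (hP k)
    _ ≤ ENNReal.ofReal s * ∑ k ∈ F, ∫⁻ x, g k x *
          ((2 ^ Module.finrank ℝ E) ^ (s - 1) * T x ^ (s - 1)) ∂μ := by
        gcongr with k hk x
        -- Only `j ≤ k` occur in the partial sum, so `2^(-k) ≤ 2^(-j)`: moving from `x` to `y` stays
        -- within the radius of the `j`-th average.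
        refine ballAvg_le_of_forall_le μ (hpow _) fun y hy => ?_
        rw [← ENNReal.mul_rpow_of_nonneg _ _ hs1.le]
        refine ENNReal.rpow_le_rpow ?_ hs1.le
        rw [hT, Finset.mul_sum]
        refine (Finset.sum_le_sum fun j hj => ballAvg_le_two_mul μ (hpow _) (g j) (x := x)
          (hy.trans ?_)).trans (Finset.sum_le_sum_of_subset (Finset.filter_subset _ _))
        have := (Finset.mem_filter.1 hj).2
        gcongr
        norm_num
    _ = ENNReal.ofReal s * ((2 ^ Module.finrank ℝ E) ^ (s - 1) *
          ∫⁻ x, (∑ k ∈ F, g k x) * T x ^ (s - 1) ∂μ) := by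
        rw [← lintegral_finsetSum _ fun k _ => hgT k, ← lintegral_const_mul _ hGT]
        congr 1
        refine lintegral_congr fun x => ?_
        rw [← Finset.sum_mul, mul_left_comm]
    _ ≤ _ := by
        rw [← mul_assoc]
        gcongr
        have := ENNReal.lintegral_mul_rpow_le_lintegral_rpow_mul_lintegral_rpow (μ := μ) hc
          (Finset.measurable_sum F fun k _ => hg k).aemeasurable hA2.aemeasurable
        rwa [show 1 / (s / (s - 1)) = 1 - 1 / s by field_simp] at this

/-- Crude bound that only supplies an a priori finite constant for the self-improvement argument;
its dependence on `F.card` disappears there. -/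
lemma lintegral_sum_ballAvg_rpow_le_card {s : ℝ} (hs : 1 ≤ s) (F : Finset ℤ)
    {g : ℤ → E → ℝ≥0∞} (hg : ∀ k, Measurable (g k)) :
    ∫⁻ x, (∑ k ∈ F, ballAvg μ ((2 : ℝ) ^ (-k)) (g k) x) ^ s ∂μ ≤
      (F.card : ℝ≥0∞) ^ (s - 1) * F.card * ∫⁻ x, (∑ k ∈ F, g k x) ^ s ∂μ := by
  have hm : ∀ k, Measurable fun x => ballAvg μ ((2 : ℝ) ^ (-k)) (g k) x ^ s := fun k =>
    (measurable_ballAvg μ _ (hg k)).pow_const s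
  calc _ ≤ ∫⁻ x, (F.card : ℝ≥0∞) ^ (s - 1) *
          ∑ k ∈ F, ballAvg μ ((2 : ℝ) ^ (-k)) (g k) x ^ s ∂μ :=
        lintegral_mono fun x => ENNReal.rpow_sum_le_const_mul_sum_rpow _ _ hs
    _ = (F.card : ℝ≥0∞) ^ (s - 1) *
          ∑ k ∈ F, ∫⁻ x, ballAvg μ ((2 : ℝ) ^ (-k)) (g k) x ^ s ∂μ := by
        rw [lintegral_const_mul _ (Finset.measurable_sum _ fun k _ => hm k),
          lintegral_finsetSum _ fun k _ => hm k]
    _ ≤ (F.card : ℝ≥0∞) ^ (s - 1) * ∑ k ∈ F, ∫⁻ x, (∑ k ∈ F, g k x) ^ s ∂μ := by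
        refine mul_le_mul_right (Finset.sum_le_sum fun k hk => ?_) _
        have hk2 : (0 : ℝ) < 2 ^ (-k) := by positivity
        refine (lintegral_mono fun x => ballAvg_rpow_le μ hk2 hs (hg k) x).trans ?_
        rw [lintegral_ballAvg μ hk2 ((hg k).pow_const s)]
        gcongr with x
        exact Finset.single_le_sum (f := fun k => g k x) (fun _ _ => zero_le) hk
    _ = _ := by rw [Finset.sum_const, nsmul_eq_mul, mul_assoc]

/-- The endpoint case `ℓ¹` of the Fefferman–Stein inequality, for averages over balls of dyadic
radii instead of the maximal function. -/
lemma lintegral_sum_ballAvg_rpow_le {s : ℝ} (hs : 1 ≤ s) :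
    ∃ C : ℝ≥0, ∀ (F : Finset ℤ) (g : ℤ → E → ℝ≥0∞), (∀ k, Measurable (g k)) →
      ∫⁻ x, (∑ k ∈ F, ballAvg μ ((2 : ℝ) ^ (-k)) (g k) x) ^ s ∂μ ≤
        C * ∫⁻ x, (∑ k ∈ F, g k x) ^ s ∂μ := by
  rcases hs.eq_or_lt with rfl | hs
  · refine ⟨1, fun F g hg => le_of_eq ?_⟩
    simp only [ENNReal.rpow_one, ENNReal.coe_one, one_mul]
    rw [lintegral_finsetSum _ fun k _ => measurable_ballAvg μ _ (hg k),
      lintegral_finsetSum _ fun k _ => hg k]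
    exact Finset.sum_congr rfl fun k _ => lintegral_ballAvg μ (by positivity) (hg k)
  set D : ℝ≥0∞ := ENNReal.ofReal s * (2 ^ Module.finrank ℝ E) ^ (s - 1) with hD
  have hs0 : 0 < s := by linarith
  have hs1 : 0 < s - 1 := by linarith
  have hDtop : D ≠ ⊤ := by
    rw [hD]
    refine ENNReal.mul_ne_top ENNReal.ofReal_ne_top (ENNReal.rpow_ne_top_of_nonneg hs1.le ?_)
    exact ENNReal.pow_ne_top ENNReal.ofNat_ne_top
  have hD0 : D ≠ 0 := by
    rw [hD]
    refine mul_ne_zero (by simpa using hs0) ?_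
    simp [ENNReal.rpow_eq_zero_iff]
  have hDs : D ^ s ≠ ⊤ := ENNReal.rpow_ne_top_of_nonneg hs0.le hDtop
  refine ⟨(D ^ s).toNNReal, fun F g hg => ?_⟩
  rw [ENNReal.coe_toNNReal hDs]
  by_cases hR : ∫⁻ x, (∑ k ∈ F, g k x) ^ s ∂μ = ⊤
  · rw [hR, ENNReal.mul_top]
    · exact le_top
    · simp [ENNReal.rpow_eq_zero_iff, hD0, hs0.le]
  -- Fixing the cardinality makes the crude constant uniform over the family, while the family stays
  -- closed under translation of the indices.
  let ι := {a : Finset ℤ × (ℤ → E → ℝ≥0∞) // a.1.card = F.card ∧ (∀ k, Measurable (a.2 k)) ∧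
    ∫⁻ x, (∑ k ∈ a.1, a.2 k x) ^ s ∂μ ≠ ⊤}
  have := ENNReal.le_mul_of_self_improving (ι := ι)
    (L := fun a => ∫⁻ x, (∑ k ∈ a.1.1, ballAvg μ ((2 : ℝ) ^ (-k)) (a.1.2 k) x) ^ s ∂μ)
    (R := fun a => ∫⁻ x, (∑ k ∈ a.1.1, a.1.2 k x) ^ s ∂μ) (fun a => a.2.2.2)
    (D := D) (t := 1 - 1 / s) (by simpa using hs0)
    (c₀ := (F.card : ℝ≥0∞) ^ (s - 1) * F.card)
    (ENNReal.mul_ne_top (ENNReal.rpow_ne_top_of_nonneg hs1.le (ENNReal.natCast_ne_top _))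
      (ENNReal.natCast_ne_top _))
    (fun a => (lintegral_sum_ballAvg_rpow_le_card μ hs.le _ a.2.2.1).trans_eq
      (by simp only [a.2.1]))
    ?_ ⟨⟨F, g⟩, rfl, hg, hR⟩
  · rwa [show 1 / (1 - (1 - 1 / s)) = s by field_simp; ring] at this
  rintro c hc hcι ⟨⟨G, h⟩, hG, hh, hfin⟩
  change ∫⁻ x, (∑ k ∈ G, h k x) ^ s ∂μ ≠ ⊤ at hfin
  change ∫⁻ x, (∑ k ∈ G, ballAvg μ ((2 : ℝ) ^ (-k)) (h k) x) ^ s ∂μ ≤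
    D * c ^ (1 - 1 / s) * ∫⁻ x, (∑ k ∈ G, h k x) ^ s ∂μ
  set R := ∫⁻ x, (∑ k ∈ G, h k x) ^ s ∂μ with hRdef
  -- Replacing `k` by `k - 1` doubles the radius `2^(-k)`, so the doubled averages are again covered
  -- by the constant `c`.
  set G' := G.map (Equiv.subRight (1 : ℤ)).toEmbedding with hG'
  have hsum : ∀ x, ∑ k ∈ G', h (k + 1) x = ∑ k ∈ G, h k x := fun x => by simp [hG']
  have hsumA : ∀ x, ∑ k ∈ G', ballAvg μ ((2 : ℝ) ^ (-k)) (h (k + 1)) x =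
      ∑ k ∈ G, ballAvg μ (2 * (2 : ℝ) ^ (-k)) (h k) x := fun x => by
    rw [hG', Finset.sum_map]
    refine Finset.sum_congr rfl fun k _ => ?_
    rw [← zpow_one_add₀ two_ne_zero]
    simp [← sub_eq_add_neg]
  have hc3 : ∫⁻ x, (∑ k ∈ G, ballAvg μ (2 * (2 : ℝ) ^ (-k)) (h k) x) ^ s ∂μ ≤ c * R := by
    have := hcι ⟨⟨G', fun k => h (k + 1)⟩, by simpa [hG'] using hG, fun k => hh _,
      by simpa only [hsum] using hfin⟩
    simpa only [hsum, hsumA] using this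
  refine (lintegral_sum_ballAvg_rpow_le_of_double μ hs G hh).trans ?_
  have ht : 0 ≤ 1 - 1 / s := by
    rw [sub_nonneg, div_le_one hs0]; exact hs.le
  rw [← hD, mul_assoc D]
  refine mul_le_mul_right ?_ _
  calc R ^ (1 / s) * _ ≤ R ^ (1 / s) * (c * R) ^ (1 - 1 / s) := by gcongr
    _ = c ^ (1 - 1 / s) * R := by
      rw [ENNReal.mul_rpow_of_nonneg _ _ ht, mul_left_comm,
        ← ENNReal.rpow_add_of_nonneg _ _ (by positivity) ht]
      simp

/-- Monotone convergence passes from finite sums to series. The shift `m` is absorbed by reindexing,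
so `C` does not depend on it. -/
lemma lintegral_tsum_ballAvg_rpow_le {s : ℝ} (hs : 1 ≤ s) :
    ∃ C : ℝ≥0, ∀ (g : ℤ → E → ℝ≥0∞), (∀ k, Measurable (g k)) → ∀ m : ℤ,
      ∫⁻ x, (∑' k, ballAvg μ ((2 : ℝ) ^ (m - k)) (g k) x) ^ s ∂μ ≤
        C * ∫⁻ x, (∑' k, g k x) ^ s ∂μ := by
  have hs0 : 0 < s := by linarith
  obtain ⟨C, hC⟩ := lintegral_sum_ballAvg_rpow_le μ hs
  refine ⟨C, ?_⟩
  have key : ∀ (g : ℤ → E → ℝ≥0∞), (∀ k, Measurable (g k)) →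
      ∫⁻ x, (∑' k, ballAvg μ ((2 : ℝ) ^ (-k)) (g k) x) ^ s ∂μ ≤
        C * ∫⁻ x, (∑' k, g k x) ^ s ∂μ := by
    intro g hg
    have h1 : ∀ x, (∑' k, ballAvg μ ((2 : ℝ) ^ (-k)) (g k) x) ^ s =
        ⨆ F : Finset ℤ, (∑ k ∈ F, ballAvg μ ((2 : ℝ) ^ (-k)) (g k) x) ^ s := fun x => by
      rw [ENNReal.tsum_eq_iSup_sum]
      exact (ENNReal.orderIsoRpow s hs0).map_iSup _
    simp_rw [h1]
    rw [lintegral_iSup_directed]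
    · refine iSup_le fun F => (hC F g hg).trans ?_
      gcongr
      exact ENNReal.sum_le_tsum _
    · exact fun F => ((Finset.measurable_sum _ fun k _ =>
        measurable_ballAvg μ _ (hg k)).pow_const s).aemeasurable
    · refine Monotone.directed_le fun F G hFG x => ?_
      exact ENNReal.rpow_le_rpow (Finset.sum_le_sum_of_subset hFG) hs0.le
  intro g hg m
  have h := key (fun k => g (k + m)) fun k => hg _
  have h1 : ∀ x, ∑' k, g (k + m) x = ∑' k, g k x := fun x =>
    (Equiv.addRight m).tsum_eq fun k => g k x
  have h2 : ∀ x, ∑' k, ballAvg μ ((2 : ℝ) ^ (-k)) (g (k + m)) x =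
      ∑' k, ballAvg μ ((2 : ℝ) ^ (m - k)) (g k) x := fun x => by
    rw [← (Equiv.addRight m).tsum_eq fun k => ballAvg μ ((2 : ℝ) ^ (m - k)) (g k) x]
    simp
  simpa only [h1, h2] using h

end BallAverageSum

/-! ### Integrable band-limited functions and test functions. -/

section BandLimited

open Metric Set

variable {V : Type*} [NormedAddCommGroup V] [InnerProductSpace ℝ V] [FiniteDimensional ℝ V]
  [MeasurableSpace V] [BorelSpace V]

/-- Bernstein–Nikolskii inequality from `L¹` to `L^∞`. -/
lemma enorm_le_measure_mul_lintegral_of_fourier_eq_zero {g : V → ℂ} (hc : Continuous g)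
    (hi : Integrable g) {ρ : ℝ} (hg : ∀ ξ, ρ < ‖ξ‖ → 𝓕 g ξ = 0) (x : V) :
    ‖g x‖ₑ ≤ volume (closedBall (0 : V) ρ) * ∫⁻ z, ‖g z‖ₑ := by
  have hF : Continuous (𝓕 g) := VectorFourier.fourierIntegral_continuous Real.continuous_fourierChar
    (by simpa using continuous_inner) hi
  have hsupp : Function.support (𝓕 g) ⊆ closedBall 0 ρ := fun ξ hξ => by
    by_contra h
    exact hξ (hg ξ (by simpa using h))
  have hFi : Integrable (𝓕 g) := hF.integrable_of_hasCompactSupport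
    (HasCompactSupport.of_support_subset_isCompact (isCompact_closedBall 0 ρ) hsupp)
  have hle : ∀ {u : V → ℂ} (w : V), ‖∫ v, 𝐞 (inner ℝ v w) • u v‖ₑ ≤ ∫⁻ v, ‖u v‖ₑ := fun w =>
    (enorm_integral_le_lintegral_enorm _).trans_eq (lintegral_congr fun v => by
      rw [← ofReal_norm, Circle.norm_smul, ofReal_norm])
  have hbound : ∀ ξ, ‖𝓕 g ξ‖ₑ ≤ ∫⁻ z, ‖g z‖ₑ := fun ξ => by
    rw [Real.fourier_eq]
    simpa using hle (u := g) (-ξ)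
  calc ‖g x‖ₑ = ‖𝓕⁻ (𝓕 g) x‖ₑ := by rw [hi.fourierInv_fourier_eq hFi hc.continuousAt]
    _ ≤ ∫⁻ ξ, ‖𝓕 g ξ‖ₑ := by
        rw [Real.fourierInv_eq]
        exact hle x
    _ = ∫⁻ ξ in closedBall 0 ρ, ‖𝓕 g ξ‖ₑ := by
        rw [← lintegral_indicator measurableSet_closedBall]
        refine lintegral_congr fun ξ => ?_
        by_cases h : ξ ∈ closedBall (0 : V) ρ
        · rw [indicator_of_mem h]
        · rw [indicator_of_notMem h, hg ξ (by simpa using h), enorm_zero]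
    _ ≤ ∫⁻ ξ in closedBall (0 : V) ρ, ∫⁻ z, ‖g z‖ₑ := lintegral_mono fun ξ => hbound ξ
    _ = _ := by rw [setLIntegral_const, mul_comm]

/-- Translation, dilation and modulation of a compactly supported test function. -/
lemma exists_schwartzMap_fourier_eq (η : 𝓢(V, ℂ)) (hη : tsupport η ⊆ closedBall 0 1) {r : ℝ}
    (hr : 0 < r) (a y : V) :
    ∃ φ : 𝓢(V, ℂ), tsupport φ ⊆ closedBall a r ∧ ∀ z, 𝓕 φ z =
      (r ^ Module.finrank ℝ V : ℝ) • (𝐞 (-inner ℝ a (z - y)) • 𝓕 η (r • (z - y))) := by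
  set u : V → ℂ := fun ζ => 𝐞 (inner ℝ ζ y) • η (r⁻¹ • (ζ - a)) with hu
  have hus : tsupport u ⊆ closedBall a r := by
    refine closure_minimal (fun ζ hζ => ?_) isClosed_closedBall
    have h1 : r⁻¹ • (ζ - a) ∈ closedBall (0 : V) 1 := hη (subset_tsupport _ fun h => hζ (by
      simp [hu, h]))
    rw [mem_closedBall_zero_iff, norm_smul, norm_inv, Real.norm_of_nonneg hr.le,
      inv_mul_le_iff₀ hr, mul_one] at h1
    rwa [mem_closedBall_iff_norm]
  have hud : ContDiff ℝ ∞ u := by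
    have h1 : ContDiff ℝ ∞ fun ζ : V => (𝐞 (inner ℝ ζ y) : ℂ) := by
      simp only [Real.fourierChar_apply]
      have h2 : ContDiff ℝ ∞ fun ζ : V => ((2 * Real.pi * inner ℝ ζ y : ℝ) : ℂ) :=
        Complex.ofRealCLM.contDiff.comp
          (contDiff_const.mul (contDiff_id.inner ℝ contDiff_const))
      exact Complex.contDiff_exp.comp (h2.mul contDiff_const)
    exact h1.mul (η.smooth'.comp (by fun_prop))
  have huc : HasCompactSupport u :=
    (isCompact_closedBall a r).of_isClosed_subset (isClosed_tsupport u) hus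
  refine ⟨huc.toSchwartzMap hud, hus, fun z => ?_⟩
  rw [SchwartzMap.fourier_coe, SchwartzMap.fourier_coe, Real.fourier_eq, Real.fourier_eq]
  set G : V → ℂ := fun ζ => 𝐞 (-inner ℝ ζ z) • u ζ with hG
  have h1 : ∫ ζ, G ζ = (r ^ Module.finrank ℝ V : ℝ) • ∫ w, G (a + r • w) := by
    have := Measure.integral_comp_smul volume (fun ζ => G (a + ζ)) r
    rw [this, integral_add_left_eq_self G a, smul_smul, abs_of_pos (by positivity),
      mul_inv_cancel₀ (by positivity), one_smul]
  change ∫ ζ, G ζ = _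
  rw [h1]
  congr 1
  rw [Circle.smul_def, smul_eq_mul, ← integral_const_mul]
  refine integral_congr_ae (.of_forall fun w => ?_)
  have h2 : r⁻¹ • (a + r • w - a) = w := by
    rw [add_sub_cancel_left, smul_smul, inv_mul_cancel₀ hr.ne', one_smul]
  simp only [hG, hu, h2, Circle.smul_def, smul_eq_mul, ← mul_assoc, ← Circle.coe_mul,
    ← AddChar.map_add_eq_mul]
  congr 3
  simp only [inner_add_left, inner_sub_right, inner_smul_left, inner_smul_right]
  simp
  ring

end BandLimited

/-! ### Pointwise control of functions of exponential type. -/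

section ExpType

open Metric Set

variable {d : ℕ}

/-- The product of a function of exponential type with a dilated Schwartz function whose Fourier
transform is supported in the unit ball is integrable and band-limited. -/
lemma ExpType.integrable_mul_and_fourier_eq_zero {r : ℝ} (hr : 0 < r)
    {f : EuclideanSpace ℝ (Fin d) → ℂ} (hf : f ∈ ExpType d r)
    (η : 𝓢(EuclideanSpace ℝ (Fin d), ℂ)) (hη : tsupport η ⊆ closedBall 0 1)
    (y : EuclideanSpace ℝ (Fin d)) :
    Integrable (fun z => f z * 𝓕 η (r • (z - y))) ∧
      ∀ ξ, 2 * r < ‖ξ‖ → 𝓕 (fun z => f z * 𝓕 η (r • (z - y))) ξ = 0 := by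
  obtain ⟨-, u, hu, hvan⟩ := hf
  have hrd : (r ^ Module.finrank ℝ (EuclideanSpace ℝ (Fin d)) : ℝ) ≠ 0 := by positivity
  refine ⟨?_, fun ξ hξ => ?_⟩
  -- Centre `0` removes the phase, so integrability is that of `f` against the test function `𝓕 φ`.
  · obtain ⟨φ, -, hφ⟩ := exists_schwartzMap_fourier_eq η hη hr 0 y
    have h := (hu (𝓕 φ)).1
    simp only [hφ, inner_zero_left, neg_zero, AddChar.map_zero_eq_one, one_smul,
      smul_mul_assoc] at h
    simpa only [mul_comm] using (integrable_smul_iff hrd _).1 h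
  -- With centre `ξ`, the pairing `u (𝓕 φ)` is the required Fourier integral up to a phase and a
  -- power of `r`. It vanishes because the ball of radius `r` about `ξ` misses the spectrum when
  -- `‖ξ‖ > 2r`.
  · obtain ⟨φ, hsupp, hφ⟩ := exists_schwartzMap_fourier_eq η hη hr ξ y
    have h0 : u (𝓕 φ) = 0 := by
      refine hvan φ (hsupp.trans fun ζ hζ => ?_)
      have hpi : r / (2 * Real.pi) < r := by
        rw [div_lt_iff₀ (by positivity)]
        nlinarith [Real.pi_gt_three]
      rw [mem_compl_iff, mem_closedBall_zero_iff, not_le]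
      rw [mem_closedBall_iff_norm] at hζ
      have : ‖ξ‖ ≤ ‖ζ‖ + ‖ζ - ξ‖ := by
        have := norm_sub_le ζ (ζ - ξ)
        rwa [sub_sub_cancel] at this
      linarith
    rw [(hu (𝓕 φ)).2] at h0
    simp only [hφ, smul_mul_assoc, integral_smul, smul_eq_zero, hrd, false_or] at h0
    rw [Real.fourier_eq]
    have h1 : ∀ z, 𝐞 (-inner ℝ z ξ) • (f z * 𝓕 η (r • (z - y))) =
        (𝐞 (-inner ℝ ξ y) : ℂ) * (𝐞 (-inner ℝ ξ (z - y)) • 𝓕 η (r • (z - y)) * f z) := fun z => by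
      have h2 : -inner ℝ z ξ = -inner ℝ ξ y + -inner ℝ ξ (z - y) := by
        rw [inner_sub_right, real_inner_comm]; ring
      rw [h2, AddChar.map_add_eq_mul, Circle.smul_def, Circle.smul_def, Circle.coe_mul]
      simp only [smul_eq_mul]
      ring
    simp_rw [h1]
    rw [integral_const_mul]
    simp only [smul_mul_assoc] at h0 ⊢
    rw [h0, mul_zero]

/-- Write `g ≤ B^(1-q) g^q` with `B = sup g` and cancel `B^(1-q)`; integrability is what makes `B`
finite. -/
lemma ENNReal.le_mul_lintegral_rpow_of_le {α : Type*} [MeasurableSpace α] {μ : Measure α}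
    {g : α → ℝ≥0∞} {K : ℝ≥0∞} (hK : ∀ x, g x ≤ K * ∫⁻ z, g z ∂μ) (hKt : K ≠ ⊤)
    (hg : Measurable g) (hi : ∫⁻ z, g z ∂μ ≠ ⊤) {q : ℝ} (hq : 0 < q) (hq1 : q ≤ 1) (x : α) :
    g x ^ q ≤ K * ∫⁻ z, g z ^ q ∂μ := by
  set B := ⨆ x, g x with hB
  have hBK : B ≤ K * ∫⁻ z, g z ∂μ := iSup_le hK
  have hBt : B ≠ ⊤ := ne_top_of_le_ne_top (ENNReal.mul_ne_top hKt hi) hBK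
  have hgB : ∀ x, g x ≤ B := fun x => le_iSup g x
  rcases eq_or_ne B 0 with h0 | h0
  · have : g x = 0 := le_antisymm (h0 ▸ hgB x) zero_le
    simp [this, hq]
  have h1 : ∫⁻ z, g z ∂μ ≤ B ^ (1 - q) * ∫⁻ z, g z ^ q ∂μ := by
    rw [← lintegral_const_mul _ (hg.pow_const q)]
    refine lintegral_mono fun z => ?_
    calc g z = g z ^ (1 - q) * g z ^ q := by
          rw [← ENNReal.rpow_add_of_nonneg _ _ (by linarith) hq.le]; simp
      _ ≤ B ^ (1 - q) * g z ^ q := by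
          exact mul_le_mul_left (ENNReal.rpow_le_rpow (hgB z) (by linarith)) _
  have h2 : B ^ (1 - q) * B ^ q ≤ B ^ (1 - q) * (K * ∫⁻ z, g z ^ q ∂μ) := by
    rw [← ENNReal.rpow_add _ _ h0 hBt, sub_add_cancel, ENNReal.rpow_one, mul_left_comm]
    exact hBK.trans (by gcongr)
  refine (ENNReal.rpow_le_rpow (hgB x) hq.le).trans
    ((ENNReal.mul_le_mul_iff_right ?_ ?_).1 h2)
  · simp [ENNReal.rpow_eq_zero_iff, h0, hBt]
  · exact ENNReal.rpow_ne_top_of_nonneg (by linarith) hBt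

/-- Plancherel–Pólya type inequality: the value of a function of exponential type `r` is controlled
by a weighted `L^q` mean at scale `r⁻¹`. -/
lemma ExpType.enorm_rpow_mul_le {q : ℝ} (hq : 0 < q)
    (η : 𝓢(EuclideanSpace ℝ (Fin d), ℂ)) (hη : tsupport η ⊆ closedBall 0 1) :
    ∃ C : ℝ≥0, ∀ r : ℝ, 0 < r → ∀ f ∈ ExpType d r, ∀ y,
      (‖f y‖ₑ * ‖𝓕 η 0‖ₑ) ^ q ≤ C * ENNReal.ofReal (r ^ d) *
        ∫⁻ z, ‖f z‖ₑ ^ q * ‖𝓕 η (r • (z - y))‖ₑ ^ min 1 q := by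
  set θ : 𝓢(EuclideanSpace ℝ (Fin d), ℂ) := 𝓕 η with hθ
  have hθc : Continuous θ := θ.continuous
  set v : ℝ≥0∞ := volume (ball (0 : EuclideanSpace ℝ (Fin d)) 1) with hv
  have hvt : v ≠ ⊤ := measure_ball_lt_top.ne
  have hK : ∀ r : ℝ, 0 < r →
      volume (closedBall (0 : EuclideanSpace ℝ (Fin d)) (2 * r)) =
        2 ^ d * v * ENNReal.ofReal (r ^ d) := fun r hr => by
    rw [Measure.addHaar_closedBall _ _ (by positivity), finrank_euclideanSpace_fin, mul_pow,
      ENNReal.ofReal_mul (by positivity), ENNReal.ofReal_pow zero_le_two]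
    simp only [ENNReal.ofReal_ofNat]
    ring
  have hsup : ∀ r : ℝ, 0 < r → ∀ f ∈ ExpType d r, ∀ y x, ‖f x * θ (r • (x - y))‖ₑ ≤
      2 ^ d * v * ENNReal.ofReal (r ^ d) * ∫⁻ z, ‖f z * θ (r • (z - y))‖ₑ := by
    intro r hr f hf y x
    obtain ⟨h1, h2⟩ := ExpType.integrable_mul_and_fourier_eq_zero hr hf η hη y
    rw [← hK r hr]
    exact enorm_le_measure_mul_lintegral_of_fourier_eq_zero
      (g := fun z => f z * θ (r • (z - y))) (hf.1.continuous.mul (by fun_prop)) h1 h2 x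
  have hCt : (2 ^ d * v : ℝ≥0∞) ≠ ⊤ := ENNReal.mul_ne_top (by simp) hvt
  rcases le_total q 1 with hq1 | hq1
  · refine ⟨(2 ^ d * v).toNNReal, fun r hr f hf y => ?_⟩
    have h := ENNReal.le_mul_lintegral_rpow_of_le (μ := volume)
      (g := fun z => ‖f z * θ (r • (z - y))‖ₑ)
      (hsup r hr f hf y) (ENNReal.mul_ne_top hCt ENNReal.ofReal_ne_top)
      (Continuous.measurable ((hf.1.continuous.mul (by fun_prop)).enorm))
      (ExpType.integrable_mul_and_fourier_eq_zero hr hf η hη y).1.2.ne hq hq1 y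
    rw [ENNReal.coe_toNNReal hCt, min_eq_right hq1]
    simpa [enorm_mul, ENNReal.mul_rpow_of_nonneg _ _ hq.le] using h
  · set I : ℝ≥0∞ := ∫⁻ z, ‖θ z‖ₑ with hI
    have hIt : I ≠ ⊤ := θ.integrable.2.ne
    have hC't : (2 ^ d * v) ^ q * I ^ (q - 1) ≠ ⊤ := ENNReal.mul_ne_top
      (ENNReal.rpow_ne_top_of_nonneg hq.le hCt)
      (ENNReal.rpow_ne_top_of_nonneg (by linarith) hIt)
    refine ⟨((2 ^ d * v) ^ q * I ^ (q - 1)).toNNReal, fun r hr f hf y => ?_⟩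
    rw [ENNReal.coe_toNNReal hC't, min_eq_left hq1]
    set w : EuclideanSpace ℝ (Fin d) → ℝ≥0∞ := fun z => ‖θ (r • (z - y))‖ₑ with hw
    have hwm : Measurable w := Continuous.measurable (by fun_prop)
    have hfm : Measurable fun z => ‖f z‖ₑ := hf.1.continuous.enorm.measurable
    have hwI : ENNReal.ofReal (r ^ d) * ∫⁻ z, w z = I := by
      have h1 : ∫⁻ z, w z = ∫⁻ z, ‖θ (r • z)‖ₑ :=
        lintegral_sub_right_eq_self (fun z => ‖θ (r • z)‖ₑ) y
      have h2 : ∫⁻ z, ‖θ (r • z)‖ₑ = ∫⁻ z, ‖θ z‖ₑ ∂(Measure.map (r • ·) volume) :=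
        (lintegral_map hθc.enorm.measurable (measurable_const_smul r)).symm
      rw [h1, h2, Measure.map_addHaar_smul _ hr.ne', lintegral_smul_measure,
        finrank_euclideanSpace_fin, smul_eq_mul, ← mul_assoc,
        ← ENNReal.ofReal_mul (by positivity), abs_of_pos (by positivity),
        mul_inv_cancel₀ (by positivity), ENNReal.ofReal_one, one_mul]
    have h := hsup r hr f hf y y
    -- Jensen for the measure `w dz` of mass `I / R`: combined with the prefactor `R^q`, this leaves
    -- exactly one power of `R`.
    have hJ := rpow_lintegral_le (volume.withDensity w) hq1 hfm.aemeasurable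
    rw [withDensity_apply _ MeasurableSet.univ, Measure.restrict_univ,
      lintegral_withDensity_eq_lintegral_mul _ hwm hfm,
      lintegral_withDensity_eq_lintegral_mul _ hwm (hfm.pow_const q)] at hJ
    simp only [Pi.mul_apply] at hJ
    set R := ENNReal.ofReal (r ^ d) with hR
    have hR0 : R ≠ 0 := by
      rw [hR, Ne, ENNReal.ofReal_eq_zero, not_le]; positivity
    have hRq : R ^ q = R * R ^ (q - 1) := by
      rw [ENNReal.rpow_sub _ _ hR0 ENNReal.ofReal_ne_top, ENNReal.rpow_one,
        ENNReal.mul_div_cancel hR0 ENNReal.ofReal_ne_top]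
    simp only [enorm_mul, sub_self, smul_zero] at h
    calc (‖f y‖ₑ * ‖θ 0‖ₑ) ^ q ≤ (2 ^ d * v * R * ∫⁻ z, w z * ‖f z‖ₑ) ^ q := by
          refine ENNReal.rpow_le_rpow (h.trans_eq ?_) hq.le
          simp only [mul_comm, hw]
      _ = (2 ^ d * v) ^ q * R ^ q * (∫⁻ z, w z * ‖f z‖ₑ) ^ q := by
          rw [ENNReal.mul_rpow_of_nonneg _ _ hq.le, ENNReal.mul_rpow_of_nonneg _ _ hq.le]
      _ ≤ (2 ^ d * v) ^ q * R ^ q * ((∫⁻ z, w z) ^ (q - 1) * ∫⁻ z, w z * ‖f z‖ₑ ^ q) := by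
          gcongr
      _ = (2 ^ d * v) ^ q * (R * ∫⁻ z, w z) ^ (q - 1) * R * ∫⁻ z, w z * ‖f z‖ₑ ^ q := by
          rw [hRq, ENNReal.mul_rpow_of_nonneg R _ (by linarith)]
          ring
      _ = _ := by
          rw [hwI]
          simp only [mul_comm, hw, ENNReal.rpow_one]

end ExpType

/-! ### Schwartz tails and the bound for the local maximal function. -/

lemma SchwartzMap.exists_one_add_norm_pow_mul_le {V : Type*} [NormedAddCommGroup V]
    [NormedSpace ℝ V] (θ : 𝓢(V, ℂ)) (N : ℕ) :
    ∃ C : ℝ, 0 ≤ C ∧ ∀ z, (1 + ‖z‖) ^ N * ‖θ z‖ ≤ C := by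
  refine ⟨2 ^ N * ((Finset.Iic (N, 0)).sup fun m => SchwartzMap.seminorm ℝ m.1 m.2) θ,
    by positivity, fun z => ?_⟩
  simpa using SchwartzMap.one_add_le_sup_seminorm_apply (𝕜 := ℝ) (m := (N, 0)) le_rfl le_rfl θ z

/-- Dyadic form of the rapid decay of a Schwartz function. -/
lemma SchwartzMap.exists_dyadic_decay {V : Type*} [NormedAddCommGroup V]
    [NormedSpace ℝ V] (θ : 𝓢(V, ℂ)) {m : ℝ} (hm : 0 < m) (N : ℕ) :
    ∃ C : ℝ≥0, ∀ z, ∃ l : ℕ, ‖z‖ ≤ 2 ^ l ∧ ‖θ z‖ₑ ^ m ≤ C * 2⁻¹ ^ (l * N) := by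
  obtain ⟨M, hM⟩ := exists_nat_ge ((N : ℝ) / m)
  obtain ⟨C, hC0, hC⟩ := θ.exists_one_add_norm_pow_mul_le M
  refine ⟨(2 ^ N * C ^ m).toNNReal, fun z => ?_⟩
  have hx : 1 ≤ 1 + ‖z‖ := by simp
  obtain ⟨n, hn1, hn2⟩ := exists_nat_pow_near hx (one_lt_two (α := ℝ))
  have hx0 : 0 < 1 + ‖z‖ := by positivity
  -- Here `2^n ≤ 1 + ‖z‖ < 2^(n+1)`; the factor `2^N` in the constant pays for rounding up.
  refine ⟨n + 1, by linarith, ?_⟩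
  have h1 : ‖θ z‖ ^ m * (2 ^ ((n + 1) * N)) ≤ 2 ^ N * C ^ m := by
    have h2 : ((2 : ℝ) ^ ((n + 1) * N)) ≤ 2 ^ N * (1 + ‖z‖) ^ N := by
      rw [pow_mul, ← mul_pow]
      gcongr
      rw [pow_succ']
      linarith
    have h3 : (1 + ‖z‖) ^ N ≤ ((1 + ‖z‖) ^ M) ^ m := by
      rw [← Real.rpow_natCast _ M, ← Real.rpow_mul hx0.le, ← Real.rpow_natCast]
      exact Real.rpow_le_rpow_of_exponent_le hx ((div_le_iff₀ hm).1 hM)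
    calc ‖θ z‖ ^ m * (2 ^ ((n + 1) * N)) ≤ ‖θ z‖ ^ m * (2 ^ N * ((1 + ‖z‖) ^ M) ^ m) := by
          gcongr
          exact h2.trans (by gcongr)
      _ = 2 ^ N * ((1 + ‖z‖) ^ M * ‖θ z‖) ^ m := by
          rw [Real.mul_rpow (by positivity) (by positivity)]; ring
      _ ≤ 2 ^ N * C ^ m := by
          gcongr
          exact hC z
  rw [← ofReal_norm, ENNReal.ofReal_rpow_of_nonneg (by positivity) hm.le, ← ENNReal.inv_pow,
    ← div_eq_mul_inv, ENNReal.le_div_iff_mul_le (by simp) (by simp)]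
  have h4 : (2 : ℝ≥0∞) ^ ((n + 1) * N) = ENNReal.ofReal (2 ^ ((n + 1) * N)) := by
    rw [ENNReal.ofReal_pow zero_le_two, ENNReal.ofReal_ofNat]
  rw [h4, ← ENNReal.ofReal_mul (by positivity)]
  exact ENNReal.ofReal_le_ofReal h1

section ExpTypeMaximal

open Metric Set

variable {d : ℕ}

lemma ExpType.enorm_rpow_le_tsum {q : ℝ} (hq : 0 < q) :
    ∃ C : ℝ≥0, ∀ r : ℝ, 0 < r → ∀ f ∈ ExpType d r, ∀ y,
      ‖f y‖ₑ ^ q ≤ C * ENNReal.ofReal (r ^ d) *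
        ∑' l : ℕ, 2⁻¹ ^ (l * (d + 1)) * ∫⁻ z in closedBall y (2 ^ l / r), ‖f z‖ₑ ^ q := by
  let b : ContDiffBump (0 : EuclideanSpace ℝ (Fin d)) := ⟨1 / 2, 1, by norm_num, by norm_num⟩
  have hbd : ContDiff ℝ ∞ fun x => (b x : ℂ) := Complex.ofRealCLM.contDiff.comp b.contDiff
  have hbs : tsupport (fun x => (b x : ℂ)) ⊆ closedBall 0 1 := by
    rw [← b.tsupport_eq]
    exact closure_mono fun x hx h => hx (by simp [h])
  have hbc : HasCompactSupport fun x => (b x : ℂ) :=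
    (isCompact_closedBall _ _).of_isClosed_subset (isClosed_tsupport _) hbs
  set η : 𝓢(EuclideanSpace ℝ (Fin d), ℂ) := hbc.toSchwartzMap hbd with hη
  have hθ0 : 𝓕 η 0 ≠ 0 := by
    rw [SchwartzMap.fourier_coe, Real.fourier_eq]
    simp only [inner_zero_right, neg_zero, AddChar.map_zero_eq_one, one_smul]
    change ∫ x, (b x : ℂ) ≠ 0
    rw [integral_complex_ofReal]
    exact_mod_cast b.integral_pos.ne'
  obtain ⟨C₁, hC₁⟩ := ExpType.enorm_rpow_mul_le hq η hbs
  -- Decay of order `d + 1` beats the volume growth `2^(ld)` and leaves the summable factor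
  -- `2^(-l)`.
  obtain ⟨C₂, hC₂⟩ := (𝓕 η).exists_dyadic_decay (m := min 1 q) (by positivity) (d + 1)
  set t : ℝ≥0∞ := ‖𝓕 η 0‖ₑ ^ q with ht
  have ht0 : t ≠ 0 := by simp [ht, ENNReal.rpow_eq_zero_iff, hθ0]
  have htt : t ≠ ⊤ := ENNReal.rpow_ne_top_of_nonneg hq.le enorm_ne_top
  have hCt : t⁻¹ * C₁ * C₂ ≠ ⊤ :=
    ENNReal.mul_ne_top (ENNReal.mul_ne_top (by simpa using ht0) (by simp)) (by simp)
  refine ⟨(t⁻¹ * C₁ * C₂).toNNReal, fun r hr f hf y => ?_⟩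
  rw [ENNReal.coe_toNNReal hCt]
  have hfm : Measurable fun z => ‖f z‖ₑ ^ q := hf.1.continuous.enorm.measurable.pow_const q
  have h := hC₁ r hr f hf y
  have h2 : ∫⁻ z, ‖f z‖ₑ ^ q * ‖𝓕 η (r • (z - y))‖ₑ ^ min 1 q ≤
      C₂ * ∑' l : ℕ, 2⁻¹ ^ (l * (d + 1)) * ∫⁻ z in closedBall y (2 ^ l / r), ‖f z‖ₑ ^ q := by
    have hind : ∀ l : ℕ, Measurable ((closedBall y (2 ^ l / r)).indicator
        fun z => ‖f z‖ₑ ^ q) := fun l => hfm.indicator measurableSet_closedBall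
    calc _ ≤ ∫⁻ z, C₂ * ∑' l : ℕ, 2⁻¹ ^ (l * (d + 1)) *
          (closedBall y (2 ^ l / r)).indicator (fun z => ‖f z‖ₑ ^ q) z := by
          refine lintegral_mono fun z => ?_
          obtain ⟨l, hl1, hl2⟩ := hC₂ (r • (z - y))
          have hz : z ∈ closedBall y (2 ^ l / r) := by
            rw [norm_smul, Real.norm_of_nonneg hr.le] at hl1
            rw [mem_closedBall_iff_norm, le_div_iff₀ hr]
            linarith
          calc _ ≤ ‖f z‖ₑ ^ q * (C₂ * 2⁻¹ ^ (l * (d + 1))) := by gcongr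
            _ = C₂ * (2⁻¹ ^ (l * (d + 1)) *
                (closedBall y (2 ^ l / r)).indicator (fun z => ‖f z‖ₑ ^ q) z) := by
                rw [indicator_of_mem hz]; ring
            _ ≤ _ := by
                gcongr
                exact ENNReal.le_tsum l
      _ = _ := by
          rw [lintegral_const_mul _ (Measurable.tsum fun l => (hind l).const_mul _),
            lintegral_tsum fun l => ((hind l).const_mul _).aemeasurable]
          congr 1
          refine tsum_congr fun l => ?_
          rw [lintegral_const_mul _ (hind l), lintegral_indicator measurableSet_closedBall]
  rw [ENNReal.mul_rpow_of_nonneg _ _ hq.le] at h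
  calc ‖f y‖ₑ ^ q = t⁻¹ * (‖f y‖ₑ ^ q * t) := by
        rw [mul_left_comm, ENNReal.inv_mul_cancel ht0 htt, mul_one]
    _ ≤ t⁻¹ * (C₁ * ENNReal.ofReal (r ^ d) * (C₂ * ∑' l : ℕ, 2⁻¹ ^ (l * (d + 1)) *
          ∫⁻ z in closedBall y (2 ^ l / r), ‖f z‖ₑ ^ q)) := by
        exact mul_le_mul_right (h.trans (mul_le_mul_right h2 _)) _
    _ = _ := by ring

lemma localMax_rpow_le {q : ℝ} (hq : 0 < q) :
    ∃ C : ℝ≥0, ∀ (n : ℕ) (k : ℤ), ∀ f ∈ ExpType d ((2 : ℝ) ^ k), ∀ x,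
      localMax n k f x ^ q ≤ C * 2 ^ (n * d) * ∑' l : ℕ, 2⁻¹ ^ l *
        ballAvg volume ((2 : ℝ) ^ (((n + l + 2 : ℕ) : ℤ) - k)) (fun z => ‖f z‖ₑ ^ q) x := by
  obtain ⟨C, hC⟩ := ExpType.enorm_rpow_le_tsum (d := d) hq
  set v : ℝ≥0∞ := volume (ball (0 : EuclideanSpace ℝ (Fin d)) 1) with hv
  have hvt : v ≠ ⊤ := measure_ball_lt_top.ne
  have hCt : (C * 4 ^ d * v : ℝ≥0∞) ≠ ⊤ := ENNReal.mul_ne_top (by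
    exact ENNReal.mul_ne_top (by simp) (by simp)) hvt
  refine ⟨(C * 4 ^ d * v).toNNReal, fun n k f hf x => ?_⟩
  rw [ENNReal.coe_toNNReal hCt]
  have hk : (0 : ℝ) < 2 ^ k := by positivity
  set S := ∑' l : ℕ, 2⁻¹ ^ l *
    ballAvg volume ((2 : ℝ) ^ (((n + l + 2 : ℕ) : ℤ) - k)) (fun z => ‖f z‖ₑ ^ q) x with hS
  suffices h : ∀ y, dist y x ≤ (2 : ℝ) ^ ((n : ℤ) - k + 1) →
      ‖f y‖ₑ ^ q ≤ C * 4 ^ d * v * 2 ^ (n * d) * S by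
    have h2 : localMax n k f x ≤ (C * 4 ^ d * v * 2 ^ (n * d) * S) ^ q⁻¹ :=
      iSup₂_le fun h' hh' => (ENNReal.le_rpow_inv_iff hq).2 (h _ (by simpa using hh'))
    exact (ENNReal.le_rpow_inv_iff hq).1 h2
  intro y hy
  refine (hC _ hk f hf y).trans ?_
  rw [hS, ← ENNReal.tsum_mul_left, ← ENNReal.tsum_mul_left]
  refine ENNReal.tsum_le_tsum fun l => ?_
  -- The exponent is chosen so that `2^(n+1) + 2^l ≤ 3 · 2^(n+l) ≤ 2^(n+l+2)`: the ball about `x`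
  -- contains the one about `y`.
  set ρ : ℝ := (2 : ℝ) ^ (((n + l + 2 : ℕ) : ℤ) - k) with hρ
  have hρ' : ρ = 2 ^ (n + l + 2) / 2 ^ k := by
    rw [hρ, zpow_sub₀ two_ne_zero, zpow_natCast]
  have hρ0 : 0 < ρ := by positivity
  have hdist : dist y x + 2 ^ l / 2 ^ k ≤ ρ := by
    rw [zpow_add_one₀ two_ne_zero, zpow_sub₀ two_ne_zero, zpow_natCast] at hy
    have h1 : (2 : ℝ) ^ n ≤ 2 ^ (n + l) := pow_le_pow_right₀ one_le_two (by omega)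
    have h2 : (2 : ℝ) ^ l ≤ 2 ^ (n + l) := pow_le_pow_right₀ one_le_two (by omega)
    calc dist y x + 2 ^ l / 2 ^ k ≤ 2 ^ n / 2 ^ k * 2 + 2 ^ l / 2 ^ k := by gcongr
      _ = (2 ^ n * 2 + 2 ^ l) / 2 ^ k := by ring
      _ ≤ 2 ^ (n + l + 2) / 2 ^ k := by
          gcongr
          rw [pow_add _ (n + l)]
          have h3 : (0 : ℝ) ≤ 2 ^ (n + l) := by positivity
          linarith
      _ = ρ := hρ'.symm
  have hvol : ENNReal.ofReal (((2 : ℝ) ^ k) ^ d) *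
      volume (closedBall (0 : EuclideanSpace ℝ (Fin d)) ρ) = (2 ^ (n + l + 2)) ^ d * v := by
    rw [Measure.addHaar_closedBall _ _ hρ0.le, finrank_euclideanSpace_fin, ← mul_assoc,
      ← ENNReal.ofReal_mul (by positivity), ← mul_pow, hρ', mul_div_cancel₀ _ hk.ne',
      ENNReal.ofReal_pow (by positivity), ENNReal.ofReal_pow zero_le_two, ENNReal.ofReal_ofNat]
  have hpow : (2⁻¹ : ℝ≥0∞) ^ (l * (d + 1)) * (2 ^ (n + l + 2)) ^ d =
      4 ^ d * 2 ^ (n * d) * 2⁻¹ ^ l := by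
    have h4 : (4 : ℝ≥0∞) = 2 ^ 2 := by norm_num
    have h1 : (2⁻¹ : ℝ≥0∞) ^ (l * d) * 2 ^ (l * d) = 1 := by
      rw [← mul_pow, ENNReal.inv_mul_cancel (by simp) (by simp), one_pow]
    calc _ = (2⁻¹ : ℝ≥0∞) ^ (l * d) * 2 ^ (l * d) * ((2 ^ 2) ^ d * 2 ^ (n * d) * 2⁻¹ ^ l) := by
          ring
      _ = _ := by rw [h1, one_mul, h4]
  calc C * ENNReal.ofReal (((2 : ℝ) ^ k) ^ d) * (2⁻¹ ^ (l * (d + 1)) *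
        ∫⁻ z in closedBall y (2 ^ l / 2 ^ k), ‖f z‖ₑ ^ q)
      ≤ C * ENNReal.ofReal (((2 : ℝ) ^ k) ^ d) * (2⁻¹ ^ (l * (d + 1)) *
        (volume (closedBall (0 : EuclideanSpace ℝ (Fin d)) ρ) *
          ballAvg volume ρ (fun z => ‖f z‖ₑ ^ q) x)) := by
        gcongr
        exact setLIntegral_closedBall_le_ballAvg volume hρ0 _ hdist
    _ = C * (2⁻¹ ^ (l * (d + 1)) * (ENNReal.ofReal (((2 : ℝ) ^ k) ^ d) *
          volume (closedBall (0 : EuclideanSpace ℝ (Fin d)) ρ))) *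
          ballAvg volume ρ (fun z => ‖f z‖ₑ ^ q) x := by ring
    _ = _ := by
        rw [hvol, ← mul_assoc (2⁻¹ ^ _), hpow]
        ring

end ExpTypeMaximal

/-! ### Summation over the tails and conclusion. -/

lemma ENNReal.rpow_tsum_two_inv_pow_mul_le {s : ℝ} (hs : 1 ≤ s) (a : ℕ → ℝ≥0∞) :
    (∑' l : ℕ, 2⁻¹ ^ l * a l) ^ s ≤ 2 ^ (s - 1) * ∑' l : ℕ, 2⁻¹ ^ l * a l ^ s := by
  -- The weights `2^(-l)` have total mass `2`, whence the factor `2^(s-1)`.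
  have h := rpow_lintegral_le (Measure.count.withDensity fun l : ℕ => (2⁻¹ : ℝ≥0∞) ^ l) hs
    (f := a) (measurable_of_countable _).aemeasurable
  rw [withDensity_apply _ MeasurableSet.univ, Measure.restrict_univ,
    lintegral_withDensity_eq_lintegral_mul _ (measurable_of_countable _)
      (measurable_of_countable _),
    lintegral_withDensity_eq_lintegral_mul _ (measurable_of_countable _)
      (measurable_of_countable _), lintegral_count, lintegral_count, lintegral_count] at h
  rwa [ENNReal.tsum_geometric_two] at h

theorem proposition6p1p1 (d : ℕ) (p q : ℝ) (hq : 0 < q) (hqp : q ≤ p) :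
    ∃ C : ℝ≥0, ∀ (n : ℕ) (f : ℤ → EuclideanSpace ℝ (Fin d) → ℂ),
      (∀ k : ℤ, f k ∈ ExpType d ((2 : ℝ) ^ k)) →
      mixedNorm p q (fun k => localMax n k (f k)) ≤
        (C : ℝ≥0∞) * (2 : ℝ≥0∞) ^ ((n : ℝ) * d / q) * mixedNorm p q (fun k x => ‖f k x‖ₑ) := by
  have hp : 0 < p := hq.trans_le hqp
  set s := p / q with hs_def
  have hs : 1 ≤ s := (one_le_div hq).2 hqp
  have hs0 : 0 < s := by positivity
  obtain ⟨A, hA⟩ := localMax_rpow_le (d := d) hq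
  obtain ⟨D, hD⟩ := lintegral_tsum_ballAvg_rpow_le
    (volume : Measure (EuclideanSpace ℝ (Fin d))) hs
  set K : ℝ≥0∞ := A ^ s * (2 ^ (s - 1) * (2 * D)) with hK
  have hKt : K ^ (1 / p) ≠ ⊤ := by
    refine ENNReal.rpow_ne_top_of_nonneg (by positivity) ?_
    have h1 : (2 : ℝ≥0∞) ^ (s - 1) ≠ ⊤ := ENNReal.rpow_ne_top_of_nonneg (by linarith) (by simp)
    have h2 : (A : ℝ≥0∞) ^ s ≠ ⊤ := ENNReal.rpow_ne_top_of_nonneg hs0.le (by simp)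
    exact ENNReal.mul_ne_top h2 (ENNReal.mul_ne_top h1 (ENNReal.mul_ne_top (by simp) (by simp)))
  refine ⟨(K ^ (1 / p)).toNNReal, fun n f hf => ?_⟩
  rw [ENNReal.coe_toNNReal hKt]
  have hnorm : ∀ g : ℤ → EuclideanSpace ℝ (Fin d) → ℝ≥0∞,
      mixedNorm p q g = (∫⁻ x, (∑' k, g k x ^ q) ^ s) ^ (1 / p) := fun g => by
    simp only [mixedNorm, ← ENNReal.rpow_mul, one_div_mul_eq_div, hs_def]
  rw [hnorm, hnorm]
  have hfm : ∀ k, Measurable fun z => ‖f k z‖ₑ ^ q := fun k =>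
    (hf k).1.continuous.enorm.measurable.pow_const q
  set T : ℕ → EuclideanSpace ℝ (Fin d) → ℝ≥0∞ := fun l x => ∑' k : ℤ,
    ballAvg volume ((2 : ℝ) ^ (((n + l + 2 : ℕ) : ℤ) - k)) (fun z => ‖f k z‖ₑ ^ q) x with hT
  have hTm : ∀ l, Measurable (T l) := fun l =>
    Measurable.tsum fun k => measurable_ballAvg volume _ (hfm k)
  set J := ∫⁻ x, (∑' k, ‖f k x‖ₑ ^ q) ^ s with hJ
  have hpt : ∀ x, (∑' k, localMax n k (f k) x ^ q) ^ s ≤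
      (A * 2 ^ (n * d)) ^ s * 2 ^ (s - 1) * ∑' l : ℕ, 2⁻¹ ^ l * T l x ^ s := fun x => by
    have h1 : ∑' k, localMax n k (f k) x ^ q ≤ A * 2 ^ (n * d) * ∑' l : ℕ, 2⁻¹ ^ l * T l x := by
      refine (ENNReal.tsum_le_tsum fun k => hA n k (f k) (hf k) x).trans_eq ?_
      rw [ENNReal.tsum_mul_left, ENNReal.tsum_comm]
      simp only [hT, ENNReal.tsum_mul_left]
    refine (ENNReal.rpow_le_rpow h1 hs0.le).trans ?_
    rw [ENNReal.mul_rpow_of_nonneg _ _ hs0.le, mul_assoc]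
    gcongr
    exact ENNReal.rpow_tsum_two_inv_pow_mul_le hs _
  have hmain : ∫⁻ x, (∑' k, localMax n k (f k) x ^ q) ^ s ≤
      K * ((2 : ℝ≥0∞) ^ (n * d)) ^ s * J := by
    have hTs : ∀ l : ℕ, Measurable fun x => 2⁻¹ ^ l * T l x ^ s := fun l =>
      ((hTm l).pow_const s).const_mul _
    calc _ ≤ ∫⁻ x, (A * 2 ^ (n * d)) ^ s * 2 ^ (s - 1) * ∑' l : ℕ, 2⁻¹ ^ l * T l x ^ s :=
          lintegral_mono hpt
      _ = (A * 2 ^ (n * d)) ^ s * 2 ^ (s - 1) * ∑' l : ℕ, 2⁻¹ ^ l * ∫⁻ x, T l x ^ s := by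
          rw [lintegral_const_mul _ (Measurable.tsum hTs),
            lintegral_tsum fun l => (hTs l).aemeasurable]
          congr 1
          exact tsum_congr fun l => lintegral_const_mul _ ((hTm l).pow_const s)
      _ ≤ (A * 2 ^ (n * d)) ^ s * 2 ^ (s - 1) * ∑' l : ℕ, 2⁻¹ ^ l * (D * J) := by
          gcongr with l
          -- The shift is `m = n + l + 2`; uniformity in `m` keeps `2^(nd)` as the only dependence
          -- on `n` and lets the sum over `l` converge.
          exact hD _ hfm _
      _ = K * ((2 : ℝ≥0∞) ^ (n * d)) ^ s * J := by
          rw [ENNReal.tsum_mul_right, ENNReal.tsum_geometric_two,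
            ENNReal.mul_rpow_of_nonneg _ _ hs0.le, hK]
          ring
  refine (ENNReal.rpow_le_rpow hmain (by positivity)).trans_eq ?_
  rw [ENNReal.mul_rpow_of_nonneg _ _ (by positivity),
    ENNReal.mul_rpow_of_nonneg _ _ (by positivity)]
  -- The remaining exponent is `nd · s · (1/p) = nd/q`.
  congr 2
  rw [← ENNReal.rpow_natCast, ← ENNReal.rpow_mul, ← ENNReal.rpow_mul]
  congr 1
  rw [hs_def]
  push_cast
  field_simp
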